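/- Let $k_0$ be a field of characteristic $0$ and let $P = k_0((x))((\partial^{-1}))$ be the skew field of formal pseudo-differential operators $L=\sum_{i\le m} a_i\partial^i$, $a_i\in k_0((x))$, multiplied by the Leibniz rule $(\sum_i a_i\partial^i)(\sum_j b_j\partial^j)=\sum_{i,j;\,l\ge 0}\binom{i}{l}\,a_i\,\frac{d^l b_j}{dx^l}\,\partial^{i+j-l}$. The order $\operatorname{ord}(L)$ of $L\neq 0$ is the largest $i$ with $a_i\ne 0$; $P_-$ is the set of operators of order $<0$ (including $0$); and $\operatorname{res}_P(L)\in k_0$ is the coefficient of $x^{-1}$ in $a_{-1}$. For $L=\partial^k+(\text{terms of order}<k)$ with $k\in\mathbb Z$, $k\neq 0$, let $L^{1/k}$ be the unique operator of the form $\partial+(\text{terms of order}<1)$ whose $k$-th power is $L$, and put $L^{j/k}=(L^{1/k})^j$ for $j\in\mathbb Z$. Theorem 2. Let $L, M\in P$ be operators of nonzero order (positive or negative), each of the form $\partial^m+(\text{terms of order}<m-1)$, where $m\in\mathbb Z$ may a priori be different for $L$ and $M$. Then the following conditions are equivalent: (i) there is $S\in 1+P_-$ such that $M=S^{-1}LS$;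 (ii) $\operatorname{ord}(L)=\operatorname{ord}(M)=:k$, and $\operatorname{res}_P(L^q)=\operatorname{res}_P(M^q)$ for all $q\in\frac1k\mathbb Z$. -/

import Mathlib

/-- The formal pseudo-differential operators `L = ∑_{i ≤ m} a_i ∂ ^ i` with coefficients `a_i` in a
commutative ring `A` with a derivation `d`; `L.coeff i` is `a_i`. The derivation is a parameter of
the type because it determines the product. -/
@[ext]
structure PseudoDiffOp {A : Type*} [CommRing A] (d : Derivation ℤ A A) where
  coeff : ℤ → A
  bdd : ∃ N : ℤ, ∀ n, N ≤ n → coeff n = 0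

namespace PseudoDiffOp

noncomputable section

open Finset

variable {A : Type*} [CommRing A] {d : Derivation ℤ A A}

theorem coeff_injective : Function.Injective (coeff : PseudoDiffOp d → ℤ → A) :=
  fun _ _ h => PseudoDiffOp.ext h

instance : Zero (PseudoDiffOp d) := ⟨⟨0, 0, fun _ _ => rfl⟩⟩

instance : Add (PseudoDiffOp d) := ⟨fun f g => ⟨f.coeff + g.coeff, by
  obtain ⟨N, hN⟩ := f.bdd
  obtain ⟨M, hM⟩ := g.bdd
  exact ⟨max N M, fun n hn => by simp [hN n (by omega), hM n (by omega)]⟩⟩⟩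

instance : Neg (PseudoDiffOp d) := ⟨fun f => ⟨-f.coeff, by
  obtain ⟨N, hN⟩ := f.bdd
  exact ⟨N, fun n hn => by simp [hN n hn]⟩⟩⟩

instance : Sub (PseudoDiffOp d) := ⟨fun f g => ⟨f.coeff - g.coeff, by
  obtain ⟨N, hN⟩ := f.bdd
  obtain ⟨M, hM⟩ := g.bdd
  exact ⟨max N M, fun n hn => by simp [hN n (by omega), hM n (by omega)]⟩⟩⟩

instance : SMul ℕ (PseudoDiffOp d) := ⟨fun c f => ⟨c • f.coeff, by
  obtain ⟨N, hN⟩ := f.bdd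
  exact ⟨N, fun n hn => by simp [hN n hn]⟩⟩⟩

instance : SMul ℤ (PseudoDiffOp d) := ⟨fun c f => ⟨c • f.coeff, by
  obtain ⟨N, hN⟩ := f.bdd
  exact ⟨N, fun n hn => by simp [hN n hn]⟩⟩⟩

/-- Addition is coefficientwise. -/
instance : AddCommGroup (PseudoDiffOp d) :=
  coeff_injective.addCommGroup coeff rfl (fun _ _ => rfl) (fun _ => rfl) (fun _ _ => rfl)
    (fun _ _ => rfl) (fun _ _ => rfl)

@[simp] theorem coeff_zero (n : ℤ) : (0 : PseudoDiffOp d).coeff n = 0 := rfl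
@[simp] theorem coeff_add (f g : PseudoDiffOp d) (n : ℤ) :
    (f + g).coeff n = f.coeff n + g.coeff n := rfl
@[simp] theorem coeff_sub (f g : PseudoDiffOp d) (n : ℤ) :
    (f - g).coeff n = f.coeff n - g.coeff n := rfl
@[simp] theorem coeff_neg (f : PseudoDiffOp d) (n : ℤ) : (-f).coeff n = -f.coeff n := rfl

/-- The operators of order `< m` (including `0`). For `m = 0` this is the subspace `P_-`. -/
def ordLT (d : Derivation ℤ A A) (m : ℤ) : AddSubgroup (PseudoDiffOp d) where
  carrier := {f | ∀ n, m ≤ n → f.coeff n = 0}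
  zero_mem' := fun _ _ => rfl
  add_mem' := fun hf hg n hn => by simp [hf n hn, hg n hn]
  neg_mem' := fun hf n hn => by simp [hf n hn]

theorem mem_ordLT {f : PseudoDiffOp d} {m : ℤ} :
    f ∈ ordLT d m ↔ ∀ n, m ≤ n → f.coeff n = 0 := Iff.rfl

theorem ordLT_mono {m m' : ℤ} (h : m ≤ m') : ordLT d m ≤ ordLT d m' :=
  fun _ hf n hn => hf n (h.trans hn)

theorem exists_mem_ordLT (f : PseudoDiffOp d) : ∃ N, f ∈ ordLT d N := f.bdd

/-- The contribution of `f_i` to the coefficient of `∂ ^ n` in the product of `∑ f_i ∂ ^ i` and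
`∑ g_j ∂ ^ j`, through the term `(i choose k) f_i d^k(g_j) ∂ ^ (i + j - k)` with `i + j - k = n`.
The index is `p = (i, k)`, and `j = n - i + k`. -/
def mulTerm (f g : ℤ → A) (d : Derivation ℤ A A) (n : ℤ) (p : ℤ × ℕ) : A :=
  Ring.choose p.1 p.2 • (f p.1 * d^[p.2] (g (n - p.1 + p.2)))

theorem mulTerm_support {f g : ℤ → A} {N M : ℤ} (hf : ∀ n, N ≤ n → f n = 0)
    (hg : ∀ n, M ≤ n → g n = 0) (n : ℤ) :
    Function.support (mulTerm f g d n) ⊆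
      ((Finset.Ico (n - M) N ×ˢ Finset.range (N + M - n).toNat : Finset (ℤ × ℕ)) :
        Set (ℤ × ℕ)) := by
  rintro ⟨i, k⟩ h
  have h1 : i < N := by
    by_contra hc
    exact h (by simp [mulTerm, hf i (by omega)])
  have h2 : n - i + k < M := by
    by_contra hc
    exact h (by simp [mulTerm, hg (n - i + k) (by omega)])
  simp only [Finset.coe_product, Set.mem_prod, Finset.coe_Ico, Set.mem_Ico, Finset.coe_range,
    Set.mem_Iio]
  exact ⟨⟨by omega, by omega⟩, by omega⟩

theorem mulTerm_finite (f g : PseudoDiffOp d) (n : ℤ) :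
    (Function.support (mulTerm f.coeff g.coeff d n)).Finite := by
  obtain ⟨N, hN⟩ := f.bdd
  obtain ⟨M, hM⟩ := g.bdd
  exact (Finset.finite_toSet _).subset (mulTerm_support hN hM n)

theorem mulTerm_eq_zero {f g : ℤ → A} {N M : ℤ} (hf : ∀ n, N ≤ n → f n = 0)
    (hg : ∀ n, M ≤ n → g n = 0) {n : ℤ} (hn : N + M - 1 ≤ n) (p : ℤ × ℕ) :
    mulTerm f g d n p = 0 := by
  rcases le_or_gt N p.1 with h | h
  · simp [mulTerm, hf p.1 h]
  · simp [mulTerm, hg (n - p.1 + p.2) (by omega)]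

/-- The product given by the Leibniz rule
`(∑ a_i ∂ ^ i) (∑ b_j ∂ ^ j) = ∑_{i, j, k ≥ 0} (i choose k) a_i d^k(b_j) ∂ ^ (i + j - k)`. The sum in
each coefficient has only finitely many nonzero terms. -/
instance : Mul (PseudoDiffOp d) := ⟨fun f g =>
  ⟨fun n => ∑ᶠ p : ℤ × ℕ, mulTerm f.coeff g.coeff d n p, by
    obtain ⟨N, hN⟩ := f.bdd
    obtain ⟨M, hM⟩ := g.bdd
    exact ⟨N + M - 1, fun n hn => by simp [mulTerm_eq_zero hN hM hn]⟩⟩⟩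

theorem coeff_mul (f g : PseudoDiffOp d) (n : ℤ) :
    (f * g).coeff n = ∑ᶠ p : ℤ × ℕ, mulTerm f.coeff g.coeff d n p := rfl

theorem mul_mem_ordLT {f g : PseudoDiffOp d} {a b : ℤ} (hf : f ∈ ordLT d a) (hg : g ∈ ordLT d b) :
    f * g ∈ ordLT d (a + b - 1) := fun n hn => by
  rw [coeff_mul]; simp [mulTerm_eq_zero hf hg hn]

instance : NonUnitalNonAssocRing (PseudoDiffOp d) where
  left_distrib f g h := by
    ext n
    rw [coeff_add, coeff_mul, coeff_mul, coeff_mul,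
      ← finsum_add_distrib (mulTerm_finite f g n) (mulTerm_finite f h n)]
    exact finsum_congr fun p => by simp [mulTerm, mul_add, iterate_map_add]
  right_distrib f g h := by
    ext n
    rw [coeff_add, coeff_mul, coeff_mul, coeff_mul,
      ← finsum_add_distrib (mulTerm_finite f h n) (mulTerm_finite g h n)]
    exact finsum_congr fun p => by simp [mulTerm, add_mul]
  zero_mul f := by
    ext n
    rw [coeff_mul]; simp [mulTerm]
  mul_zero f := by
    ext n
    rw [coeff_mul]; simp [mulTerm, iterate_map_zero]

/-- The operator `a ∂ ^ i`. -/
def mono (d : Derivation ℤ A A) (a : A) (i : ℤ) : PseudoDiffOp d :=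
  ⟨fun n => if n = i then a else 0, i + 1, fun n hn => if_neg (by omega)⟩

theorem coeff_mono (a : A) (i n : ℤ) : (mono d a i).coeff n = if n = i then a else 0 := rfl

theorem mono_mem (a : A) (i : ℤ) : mono d a i ∈ ordLT d (i + 1) :=
  fun n hn => if_neg (by omega)

theorem coeff_mul_mono (f : PseudoDiffOp d) (c : A) (l n : ℤ) {w : ℕ}
    (hf : f ∈ ordLT d (n + w - l + 1)) :
    (f * mono d c l).coeff n =
      ∑ s ∈ range (w + 1), Ring.choose (n + s - l) s • (f.coeff (n + s - l) * d^[s] c) := by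
  rw [coeff_mul, finsum_eq_sum_of_support_subset (s := (range (w + 1)).image
    (fun s : ℕ => (n + s - l, s)))]
  · rw [sum_image (by intro a _ b _ h; exact (Prod.ext_iff.1 h).2)]
    refine sum_congr rfl fun s _ => ?_
    simp only [mulTerm, coeff_mono]
    rw [if_pos (by omega)]
  · rintro ⟨i, k⟩ h
    have h1 : i < n + w - l + 1 := by
      by_contra hc
      exact h (by simp [mulTerm, hf i (by omega)])
    have h2 : n - i + k = l := by
      by_contra hc
      exact h (by simp [mulTerm, coeff_mono, hc])
    simp only [coe_image, Set.mem_image, coe_range, Set.mem_Iio, Prod.mk.injEq]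
    exact ⟨k, by omega, by omega, rfl⟩

theorem coeff_mono_mul (a : A) (i : ℤ) (g : PseudoDiffOp d) (n : ℤ) {w : ℕ}
    (hg : g ∈ ordLT d (n - i + w + 1)) :
    (mono d a i * g).coeff n =
      ∑ k ∈ range (w + 1), Ring.choose i k • (a * d^[k] (g.coeff (n - i + k))) := by
  rw [coeff_mul, finsum_eq_sum_of_support_subset (s := (range (w + 1)).image
    (fun s : ℕ => (i, s)))]
  · rw [sum_image (by intro a _ b _ h; exact (Prod.ext_iff.1 h).2)]
    refine sum_congr rfl fun s _ => ?_
    simp [mulTerm, coeff_mono]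
  · rintro ⟨i', k⟩ h
    have h1 : i' = i := by
      by_contra hc
      exact h (by simp [mulTerm, coeff_mono, hc])
    have h2 : n - i' + k < n - i + w + 1 := by
      by_contra hc
      exact h (by simp [mulTerm, hg (n - i' + k) (by omega)])
    simp only [coe_image, Set.mem_image, coe_range, Set.mem_Iio, Prod.mk.injEq]
    exact ⟨k, by omega, by omega, rfl⟩

theorem coeff_mono_mul_mono (a b : A) (i j n : ℤ) {w : ℕ} (hw : n + w = i + j) :
    (mono d a i * mono d b j).coeff n = Ring.choose i w • (a * d^[w] b) := by
  rw [coeff_mono_mul _ _ _ _ (w := w) (ordLT_mono (by omega) (mono_mem b j)),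
    sum_eq_single w]
  · rw [coeff_mono, if_pos (by omega)]
  · intro k _ hk
    rw [coeff_mono, if_neg (by omega)]
    simp [iterate_map_zero]
  · simp

theorem iterate_leibniz (k : ℕ) (a b : A) :
    d^[k] (a * b) = ∑ p ∈ antidiagonal k, k.choose p.1 • (d^[p.1] a * d^[p.2] b) := by
  induction k with
  | zero => simp
  | succ k ih =>
    rw [Function.iterate_succ_apply', ih, map_sum]
    simp only [map_nsmul, Derivation.leibniz, ← Function.iterate_succ_apply' d, smul_eq_mul]
    have := Finset.sum_antidiagonal_choose_succ_nsmul (M := A)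
      (fun i j => d^[i] a * d^[j] b) k
    rw [this, ← sum_add_distrib]
    refine sum_congr rfl fun p hp => ?_
    have hp' : p.1 + p.2 = k := HasAntidiagonal.mem_antidiagonal.1 hp
    rw [mul_comm (d^[p.2] b), smul_add, Nat.choose_symm_of_eq_add hp'.symm]

theorem choose_comb (i j : ℤ) (t u : ℕ) :
    ∑ p ∈ antidiagonal u, ((t + p.1).choose t : ℤ) * Ring.choose i (t + p.1) * Ring.choose j p.2
      = Ring.choose i t * Ring.choose (i + j - t) u := by
  have h := Ring.add_choose_eq (R := ℤ) (r := i - t) (s := j) u (Commute.all _ _)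
  rw [show i + j - t = i - t + j by ring, h, mul_sum]
  refine sum_congr rfl fun p _ => ?_
  have := Ring.choose_smul_choose (R := ℤ) i (n := t + p.1) (k := t) (by omega)
  rw [Nat.add_sub_cancel_left, nsmul_eq_mul] at this
  rw [this]; ring

theorem mono_assoc (a b c : A) (i j l : ℤ) :
    mono d a i * mono d b j * mono d c l = mono d a i * (mono d b j * mono d c l) := by
  ext n
  by_cases hw : i + j + l < n
  · have h1 := mul_mem_ordLT (mul_mem_ordLT (mono_mem (d := d) a i) (mono_mem b j)) (mono_mem c l)
    have h2 := mul_mem_ordLT (mono_mem (d := d) a i) (mul_mem_ordLT (mono_mem b j) (mono_mem c l))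
    rw [h1 n (by omega), h2 n (by omega)]
  obtain ⟨w, hw⟩ : ∃ w : ℕ, n + w = i + j + l := ⟨(i + j + l - n).toNat, by omega⟩
  rw [coeff_mul_mono _ _ _ _ (w := w)
      (ordLT_mono (by omega) (mul_mem_ordLT (mono_mem a i) (mono_mem b j))),
    coeff_mono_mul _ _ _ _ (w := w)
      (ordLT_mono (by omega) (mul_mem_ordLT (mono_mem b j) (mono_mem c l)))]
  rw [← Nat.sum_antidiagonal_eq_sum_range_succ_mk
      (fun p => Ring.choose (n + p.1 - l) p.1 •
        ((mono d a i * mono d b j).coeff (n + p.1 - l) * d^[p.1] c)),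
    ← Nat.sum_antidiagonal_eq_sum_range_succ_mk
      (fun p => Ring.choose i p.1 •
        (a * d^[p.1] ((mono d b j * mono d c l).coeff (n - i + p.1))))]
  have hL : ∀ p ∈ antidiagonal w, Ring.choose (n + p.1 - l) p.1 •
        ((mono d a i * mono d b j).coeff (n + p.1 - l) * d^[p.1] c) =
      (Ring.choose i p.2 * Ring.choose (i + j - p.2) p.1) • (a * (d^[p.2] b * d^[p.1] c)) := by
    intro p hp
    rw [HasAntidiagonal.mem_antidiagonal] at hp
    rw [coeff_mono_mul_mono _ _ _ _ _ (w := p.2) (by omega),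
      show n + p.1 - l = i + j - p.2 by omega, smul_mul_assoc, smul_smul, mul_comm, mul_assoc]
  have hR : ∀ p ∈ antidiagonal w, Ring.choose i p.1 •
        (a * d^[p.1] ((mono d b j * mono d c l).coeff (n - i + p.1))) =
      ∑ q ∈ antidiagonal p.1, ((q.1 + q.2).choose q.1 * Ring.choose i (q.1 + q.2) *
        Ring.choose j p.2) • (a * (d^[q.1] b * d^[q.2 + p.2] c)) := by
    intro p hp
    rw [HasAntidiagonal.mem_antidiagonal] at hp
    rw [coeff_mono_mul_mono _ _ _ _ _ (w := p.2) (by omega), iterate_map_zsmul, iterate_leibniz,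
      mul_smul_comm, mul_sum, smul_sum, smul_sum]
    refine sum_congr rfl fun q hq => ?_
    rw [HasAntidiagonal.mem_antidiagonal] at hq
    rw [hq, Function.iterate_add_apply, mul_smul_comm, ← natCast_zsmul, smul_smul, smul_smul]
    congr 1
    ring
  have hL' : ∀ p ∈ antidiagonal w,
      (Ring.choose i p.2 * Ring.choose (i + j - p.2) p.1) • (a * (d^[p.2] b * d^[p.1] c)) =
      ∑ q ∈ antidiagonal p.1, ((p.2 + q.1).choose p.2 * Ring.choose i (p.2 + q.1) *
        Ring.choose j q.2) • (a * (d^[p.2] b * d^[q.1 + q.2] c)) := by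
    intro p _
    rw [← choose_comb, sum_smul]
    refine sum_congr rfl fun q hq => ?_
    rw [HasAntidiagonal.mem_antidiagonal] at hq
    rw [hq]
  rw [sum_congr rfl hL, sum_congr rfl hR, sum_congr rfl hL', sum_sigma', sum_sigma']
  refine sum_nbij' (fun x => ⟨(x.1.2 + x.2.1, x.2.2), (x.1.2, x.2.1)⟩)
    (fun x => ⟨(x.2.2 + x.1.2, x.2.1), (x.2.2, x.1.2)⟩) ?_ ?_ ?_ ?_ ?_
  · rintro ⟨⟨x1, x2⟩, ⟨y1, y2⟩⟩ h
    simp only [mem_sigma, HasAntidiagonal.mem_antidiagonal] at h ⊢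
    exact ⟨by omega, trivial⟩
  · rintro ⟨⟨x1, x2⟩, ⟨y1, y2⟩⟩ h
    simp only [mem_sigma, HasAntidiagonal.mem_antidiagonal] at h ⊢
    exact ⟨by omega, trivial⟩
  · rintro ⟨⟨x1, x2⟩, ⟨y1, y2⟩⟩ h
    simp only [mem_sigma, HasAntidiagonal.mem_antidiagonal] at h ⊢
    obtain ⟨h1, rfl⟩ := h
    rfl
  · rintro ⟨⟨x1, x2⟩, ⟨y1, y2⟩⟩ h
    simp only [mem_sigma, HasAntidiagonal.mem_antidiagonal] at h ⊢
    obtain ⟨h1, rfl⟩ := h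
    rfl
  · rintro ⟨⟨x1, x2⟩, ⟨y1, y2⟩⟩ h
    rfl

theorem exists_trunc (f : PseudoDiffOp d) (m : ℤ) :
    ∃ f' ∈ AddSubgroup.closure (Set.range fun p : A × ℤ => mono d p.1 p.2),
      f - f' ∈ ordLT d m := by
  obtain ⟨N, hN⟩ := f.bdd
  refine ⟨∑ i ∈ Finset.Ico m N, mono d (f.coeff i) i,
    sum_mem fun i _ => AddSubgroup.subset_closure ⟨(f.coeff i, i), rfl⟩, fun n hn => ?_⟩
  have : (∑ i ∈ Finset.Ico m N, mono d (f.coeff i) i).coeff n =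
      ∑ i ∈ Finset.Ico m N, (mono d (f.coeff i) i).coeff n :=
    map_sum (⟨⟨fun g => g.coeff n, rfl⟩, fun _ _ => rfl⟩ : PseudoDiffOp d →+ A) _ _
  rw [coeff_sub, this]
  simp only [coeff_mono, Finset.sum_ite_eq, Finset.mem_Ico]
  split_ifs with h
  · simp
  · rw [hN n (by omega), sub_zero]

theorem mul_assoc_of_closure {f g h : PseudoDiffOp d}
    (hf : f ∈ AddSubgroup.closure (Set.range fun p : A × ℤ => mono d p.1 p.2))
    (hg : g ∈ AddSubgroup.closure (Set.range fun p : A × ℤ => mono d p.1 p.2))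
    (hh : h ∈ AddSubgroup.closure (Set.range fun p : A × ℤ => mono d p.1 p.2)) :
    f * g * h = f * (g * h) := by
  induction hf using AddSubgroup.closure_induction with
  | zero => simp
  | add x y _ _ hx hy => simp [add_mul, hx, hy]
  | neg x _ hx => simp [hx]
  | mem x hx =>
    obtain ⟨⟨a, i⟩, rfl⟩ := hx
    induction hg using AddSubgroup.closure_induction with
    | zero => simp
    | add x y _ _ hx hy => simp [add_mul, mul_add, hx, hy]
    | neg x _ hx => simp [hx]
    | mem x hx =>
      obtain ⟨⟨b, j⟩, rfl⟩ := hx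
      induction hh using AddSubgroup.closure_induction with
      | zero => simp
      | add x y _ _ hx hy => simp [mul_add, hx, hy]
      | neg x _ hx => simp [hx]
      | mem x hx =>
        obtain ⟨⟨c, l⟩, rfl⟩ := hx
        exact mono_assoc a b c i j l

protected theorem mul_assoc (f g h : PseudoDiffOp d) : f * g * h = f * (g * h) := by
  ext n
  obtain ⟨a, ha⟩ := f.bdd
  obtain ⟨b, hb⟩ := g.bdd
  obtain ⟨c, hc⟩ := h.bdd
  obtain ⟨f', hf', hf⟩ := exists_trunc f (min a (n + 2 - b - c))
  obtain ⟨g', hg', hg⟩ := exists_trunc g (min b (n + 2 - a - c))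
  obtain ⟨h', hh', hh⟩ := exists_trunc h (min c (n + 2 - a - b))
  have ha' : f' ∈ ordLT d a := by
    simpa using (ordLT d a).sub_mem ha (ordLT_mono (min_le_left _ _) hf)
  have hb' : g' ∈ ordLT d b := by
    simpa using (ordLT d b).sub_mem hb (ordLT_mono (min_le_left _ _) hg)
  have e1 : f * g * h = f' * g' * h' +
      ((f - f') * g * h + f' * (g - g') * h + f' * g' * (h - h')) := by
    simp only [sub_mul, mul_sub]; abel
  have e2 : f * (g * h) = f' * (g' * h') +
      ((f - f') * (g * h) + f' * ((g - g') * h) + f' * (g' * (h - h'))) := by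
    simp only [sub_mul, mul_sub]; abel
  have z1 := mul_mem_ordLT (mul_mem_ordLT hf hb) hc n (by omega)
  have z2 := mul_mem_ordLT (mul_mem_ordLT ha' hg) hc n (by omega)
  have z3 := mul_mem_ordLT (mul_mem_ordLT ha' hb') hh n (by omega)
  have y1 := mul_mem_ordLT hf (mul_mem_ordLT hb hc) n (by omega)
  have y2 := mul_mem_ordLT ha' (mul_mem_ordLT hg hc) n (by omega)
  have y3 := mul_mem_ordLT ha' (mul_mem_ordLT hb' hh) n (by omega)
  rw [e1, e2, mul_assoc_of_closure hf' hg' hh']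
  simp only [coeff_add, z1, z2, z3, y1, y2, y3]

instance : One (PseudoDiffOp d) := ⟨mono d 1 0⟩

theorem one_def : (1 : PseudoDiffOp d) = mono d 1 0 := rfl

instance : Ring (PseudoDiffOp d) where
  mul_assoc := PseudoDiffOp.mul_assoc
  one_mul f := by
    ext n
    obtain ⟨N, hN⟩ := f.bdd
    rw [one_def, coeff_mono_mul _ _ _ _ (w := (N - n).toNat) (ordLT_mono (by omega) hN),
      sum_eq_single 0]
    · simp
    · intro k _ hk
      obtain ⟨k, rfl⟩ := Nat.exists_eq_succ_of_ne_zero hk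
      rw [Ring.choose_zero_succ, zero_smul]
    · simp
  mul_one f := by
    ext n
    obtain ⟨N, hN⟩ := f.bdd
    have h1 : ∀ k : ℕ, d^[k + 1] (1 : A) = 0 := fun k => by
      rw [Function.iterate_succ_apply, Derivation.map_one_eq_zero, iterate_map_zero]
    rw [one_def, coeff_mul_mono _ _ _ _ (w := (N - n).toNat) (ordLT_mono (by omega) hN),
      sum_eq_single 0]
    · simp
    · intro k _ hk
      obtain ⟨k, rfl⟩ := Nat.exists_eq_succ_of_ne_zero hk
      rw [h1, mul_zero, smul_zero]
    · simp
  neg_add_cancel := neg_add_cancel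
  zsmul := (· • ·)
  zsmul_zero' := SubNegMonoid.zsmul_zero'
  zsmul_succ' := SubNegMonoid.zsmul_succ'
  zsmul_neg' := SubNegMonoid.zsmul_neg'
  sub_eq_add_neg := sub_eq_add_neg

theorem coeff_mul_top {f g : PseudoDiffOp d} {a b : ℤ} (hf : f ∈ ordLT d (a + 1))
    (hg : g ∈ ordLT d (b + 1)) : (f * g).coeff (a + b) = f.coeff a * g.coeff b := by
  have e : f * g = mono d (f.coeff a) a * g + (f - mono d (f.coeff a) a) * g := by
    rw [sub_mul]; abel
  have h1 : f - mono d (f.coeff a) a ∈ ordLT d a := fun n hn => by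
    rcases hn.eq_or_lt with rfl | h
    · simp [coeff_mono]
    · rw [coeff_sub, hf n (by omega), coeff_mono, if_neg (by omega), sub_zero]
  rw [e, coeff_add, mul_mem_ordLT h1 hg _ (by omega),
    coeff_mono_mul _ _ _ _ (w := 0) (ordLT_mono (by omega) hg)]
  simp

theorem one_mem_ordLT : (1 : PseudoDiffOp d) ∈ ordLT d 1 := mono_mem 1 0

theorem pow_mem_ordLT {f : PseudoDiffOp d} (hf : f ∈ ordLT d 0) (p : ℕ) :
    f ^ p ∈ ordLT d (1 - p) := by
  induction p with
  | zero => simpa using one_mem_ordLT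
  | succ p ih =>
    rw [pow_succ]
    exact ordLT_mono (by push_cast; omega) (mul_mem_ordLT ih hf)

theorem exists_limit (F : ℕ → PseudoDiffOp d) (hF : ∀ j : ℕ, F (j + 1) - F j ∈ ordLT d (1 - j)) :
    ∃ G, ∀ j : ℕ, G - F j ∈ ordLT d (1 - j) := by
  have key : ∀ P Q : ℕ, P ≤ Q → F Q - F P ∈ ordLT d (1 - P) := by
    intro P Q h
    induction Q, h using Nat.le_induction with
    | base => simp
    | succ Q h ih =>
      rw [← sub_add_sub_cancel (F (Q + 1)) (F Q)]
      exact add_mem (ordLT_mono (by omega) (hF Q)) ih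
  obtain ⟨N, hN⟩ := (F 0).bdd
  refine ⟨⟨fun n => (F (1 - n).toNat).coeff n, max N 1, fun n hn => ?_⟩, fun P n hn => ?_⟩
  · rw [show (1 - n).toNat = 0 by omega]
    exact hN n (by omega)
  · have h := key (1 - n).toNat P (by omega) n (by omega)
    rw [coeff_sub, sub_eq_zero] at h ⊢
    exact h.symm

theorem eq_zero_of_forall_mem {f : PseudoDiffOp d} {c : ℤ} (h : ∀ j : ℕ, f ∈ ordLT d (c - j)) :
    f = 0 := by
  ext n
  exact h (c - n).toNat n (by omega)

theorem exists_right_inv {N : PseudoDiffOp d} (hN : N ∈ ordLT d 0) :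
    ∃ G, (1 - N) * G = 1 := by
  obtain ⟨G, hG⟩ := exists_limit (fun j => ∑ p ∈ range j, N ^ p) fun j => by
    simpa only [sum_range_succ, add_sub_cancel_left] using pow_mem_ordLT hN j
  refine ⟨G, sub_eq_zero.1 (eq_zero_of_forall_mem (c := 1) fun P => ?_)⟩
  have e : (1 - N) * G - 1 = (1 - N) * (G - ∑ p ∈ range P, N ^ p) - N ^ P := by
    rw [mul_sub, mul_neg_geom_sum]; abel
  rw [e]
  refine sub_mem (ordLT_mono (by omega) (mul_mem_ordLT (sub_mem one_mem_ordLT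
    (ordLT_mono (by norm_num) hN)) (hG P))) (pow_mem_ordLT hN P)

section Order

/-- The order of `L = ∑ a_i ∂ ^ i`: the largest `m` with `a_m ≠ 0` (and `0` for `L = 0`). -/
def ord (L : PseudoDiffOp d) : ℤ := sSup {n | L.coeff n ≠ 0}

theorem bddAbove_support (L : PseudoDiffOp d) : BddAbove {n | L.coeff n ≠ 0} := by
  obtain ⟨N, hN⟩ := L.bdd
  exact ⟨N, fun n hn => le_of_not_ge fun h => hn (hN n h)⟩

theorem coeff_ord_ne_zero {L : PseudoDiffOp d} (hL : L ≠ 0) : L.coeff L.ord ≠ 0 := by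
  have hne : {n | L.coeff n ≠ 0}.Nonempty := by
    by_contra h
    exact hL (PseudoDiffOp.ext (funext fun n => by
      by_contra hn
      exact h ⟨n, hn⟩))
  exact Int.csSup_mem hne L.bddAbove_support

theorem mem_ordLT_ord (L : PseudoDiffOp d) : L ∈ ordLT d (L.ord + 1) := fun n hn => by
  by_contra h
  have := le_csSup L.bddAbove_support (show n ∈ {n | L.coeff n ≠ 0} from h)
  change n ≤ L.ord at this
  omega

end Order

section DivisionRing

variable {K : Type*} [Field K] {δ : Derivation ℤ K K}

instance : Nontrivial (PseudoDiffOp δ) :=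
  ⟨⟨1, 0, fun h => by simpa [one_def, coeff_mono] using congrArg (fun f => f.coeff 0) h⟩⟩

theorem exists_mul_eq_one {L : PseudoDiffOp δ} (hL : L ≠ 0) : ∃ X, L * X = 1 := by
  have hT : L * mono δ 1 (-L.ord) * mono δ (L.coeff L.ord)⁻¹ 0 - 1 ∈ ordLT δ 0 := by
    have m1 := mul_mem_ordLT L.mem_ordLT_ord (mono_mem (d := δ) 1 (-L.ord))
    have m2 := mul_mem_ordLT m1 (mono_mem (d := δ) (L.coeff L.ord)⁻¹ 0)
    intro n hn
    rcases hn.eq_or_lt with rfl | h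
    · have t1 := coeff_mul_top L.mem_ordLT_ord (mono_mem (d := δ) 1 (-L.ord))
      have t2 := coeff_mul_top (a := 0) (b := 0) (ordLT_mono (by omega) m1)
        (mono_mem (d := δ) (L.coeff L.ord)⁻¹ 0)
      rw [add_neg_cancel] at t1
      rw [coeff_sub]
      rw [add_zero] at t2
      rw [t2, t1]
      simp [coeff_mono, one_def, coeff_ord_ne_zero hL]
    · rw [coeff_sub, m2 n (by omega), one_def, coeff_mono, if_neg (by omega), sub_zero]
  obtain ⟨G, hG⟩ := exists_right_inv (neg_mem hT)
  refine ⟨mono δ 1 (-L.ord) * mono δ (L.coeff L.ord)⁻¹ 0 * G, ?_⟩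
  rw [← hG]
  simp [mul_assoc]

open Classical in
instance : Inv (PseudoDiffOp δ) := ⟨fun L => if h : L = 0 then 0 else (exists_mul_eq_one h).choose⟩

theorem inv_of_ne {L : PseudoDiffOp δ} (h : L ≠ 0) : L⁻¹ = (exists_mul_eq_one h).choose :=
  dif_neg h

instance : DivisionRing (PseudoDiffOp δ) where
  inv_zero := dif_pos rfl
  mul_inv_cancel L hL := by
    rw [inv_of_ne hL]
    exact (exists_mul_eq_one hL).choose_spec
  nnqsmul := _
  nnqsmul_def := fun _ _ => rfl
  qsmul := _
  qsmul_def := fun _ _ => rfl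

/-- The operator `∂`. -/
def D (δ : Derivation ℤ K K) : PseudoDiffOp δ := mono δ 1 1

theorem ord_eq {L : PseudoDiffOp δ} {m : ℤ} (h : L ∈ ordLT δ (m + 1)) (h0 : L.coeff m ≠ 0) :
    L.ord = m := by
  have h1 := coeff_ord_ne_zero (L := L) (by rintro rfl; exact h0 rfl)
  refine le_antisymm ?_ ?_
  · by_contra hc
    exact h1 (h _ (by omega))
  · by_contra hc
    exact h0 (L.mem_ordLT_ord _ (by omega))

/-- `L = ∂ ^ m + (terms of order < m)`. -/
def IsMonic (L : PseudoDiffOp δ) (m : ℤ) : Prop := L ∈ ordLT δ (m + 1) ∧ L.coeff m = 1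

theorem IsMonic.ord_eq {L : PseudoDiffOp δ} {m : ℤ} (h : IsMonic L m) : L.ord = m :=
  PseudoDiffOp.ord_eq h.1 (by rw [h.2]; exact one_ne_zero)

theorem IsMonic.mul {L M : PseudoDiffOp δ} {a b : ℤ} (hL : IsMonic L a) (hM : IsMonic M b) :
    IsMonic (L * M) (a + b) :=
  ⟨ordLT_mono (by omega) (mul_mem_ordLT hL.1 hM.1), by
    rw [coeff_mul_top hL.1 hM.1, hL.2, hM.2, one_mul]⟩

theorem isMonic_one : IsMonic (1 : PseudoDiffOp δ) 0 := ⟨one_mem_ordLT, rfl⟩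

theorem isMonic_D : IsMonic (D δ) 1 := ⟨mono_mem 1 1, rfl⟩

theorem IsMonic.pow {L : PseudoDiffOp δ} (hL : IsMonic L 1) (n : ℕ) : IsMonic (L ^ n) n := by
  induction n with
  | zero => exact isMonic_one
  | succ n ih =>
    rw [pow_succ]
    exact_mod_cast ih.mul hL

theorem IsMonic.inv {L : PseudoDiffOp δ} {m : ℤ} (hL : IsMonic L m) : IsMonic L⁻¹ (-m) := by
  have h0 : L ≠ 0 := by
    rintro rfl
    exact zero_ne_one hL.2
  have h1 := coeff_mul_top hL.1 L⁻¹.mem_ordLT_ord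
  have h2 := coeff_ord_ne_zero (inv_ne_zero h0)
  rw [mul_inv_cancel₀ h0, hL.2, one_mul, one_def, coeff_mono] at h1
  split_ifs at h1 with h
  · have h3 : L⁻¹.ord = -m := by omega
    exact ⟨h3 ▸ L⁻¹.mem_ordLT_ord, by rw [← h3, h1]⟩
  · exact absurd h1.symm h2

theorem IsMonic.add {R E : PseudoDiffOp δ} {m : ℤ} (hR : IsMonic R 1) (hm : m ≤ 0)
    (hE : E ∈ ordLT δ (m + 1)) : IsMonic (R + E) 1 :=
  ⟨add_mem hR.1 (ordLT_mono (by omega) hE), by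
    rw [coeff_add, hR.2, hE 1 (by omega), add_zero]⟩

theorem add_pow_sub_pow {R E : PseudoDiffOp δ} {m : ℤ} (hR : IsMonic R 1) (hm : m ≤ 0)
    (hE : E ∈ ordLT δ (m + 1)) (n : ℕ) :
    (R + E) ^ n - R ^ n ∈ ordLT δ (m + n) ∧
      ((R + E) ^ n - R ^ n).coeff (m + n - 1) = n * E.coeff m := by
  induction n with
  | zero => simp
  | succ n ih =>
    have e : (R + E) ^ (n + 1) - R ^ (n + 1) =
        (R + E) ^ n * E + ((R + E) ^ n - R ^ n) * R := by
      rw [pow_succ, pow_succ, mul_add, sub_mul]; abel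
    have hn := (hR.add hm hE).pow n
    have ih1 : (R + E) ^ n - R ^ n ∈ ordLT δ (m + n - 1 + 1) := by simpa using ih.1
    rw [e]
    refine ⟨add_mem (ordLT_mono (by push_cast; omega) (mul_mem_ordLT hn.1 hE))
      (ordLT_mono (by push_cast; omega) (mul_mem_ordLT ih.1 hR.1)), ?_⟩
    have t1 := coeff_mul_top hn.1 hE
    have t2 := coeff_mul_top ih1 hR.1
    rw [show m + ((n + 1 : ℕ) : ℤ) - 1 = n + m by push_cast; ring, coeff_add, t1,
      show (n : ℤ) + m = m + n - 1 + 1 by ring, t2, hn.2, hR.2, ih.2]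
    push_cast
    ring

theorem exists_pow_eq [CharZero K] {L : PseudoDiffOp δ} {n : ℕ} (hn : n ≠ 0) (hL : IsMonic L n) :
    ∃ R, IsMonic R 1 ∧ R ^ n = L := by
  let F : ℕ → PseudoDiffOp δ := fun j => Nat.rec (D δ)
    (fun j R => R + mono δ ((L - R ^ n).coeff (n - 1 - j) / n) (-j)) j
  have hF : ∀ j, F (j + 1) = F j + mono δ ((L - F j ^ n).coeff (n - 1 - j) / n) (-j) :=
    fun _ => rfl
  have key : ∀ j, IsMonic (F j) 1 ∧ L - F j ^ n ∈ ordLT δ (n - j) := by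
    intro j
    induction j with
    | zero =>
      refine ⟨isMonic_D, fun i hi => ?_⟩
      have h := (isMonic_D (δ := δ)).pow n
      change (L - D δ ^ n).coeff i = 0
      rcases eq_or_ne i n with rfl | hne
      · rw [coeff_sub, hL.2, h.2, sub_self]
      · rw [coeff_sub, hL.1 i (by push_cast at hi; omega), h.1 i (by push_cast at hi; omega),
          sub_self]
    | succ j ih =>
      have hE := mono_mem (d := δ) ((L - F j ^ n).coeff (n - 1 - j) / n) (-j)
      obtain ⟨h1, h2⟩ := add_pow_sub_pow ih.1 (by omega) hE n
      rw [hF]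
      refine ⟨ih.1.add (by omega) hE, fun i hi => ?_⟩
      rw [← sub_sub_sub_cancel_right _ _ (F j ^ n), coeff_sub]
      rcases eq_or_ne i (n - 1 - j) with rfl | hne
      · rw [show (n : ℤ) - 1 - j = -j + n - 1 by ring] at h2 ⊢
        rw [h2, coeff_mono, if_pos rfl]
        field_simp
        ring
      · rw [ih.2 i (by push_cast at hi; omega), h1 i (by push_cast at hi; omega), sub_zero]
  obtain ⟨R, hR⟩ := exists_limit F fun j => by
    rw [hF, add_sub_cancel_left]
    exact ordLT_mono (by omega) (mono_mem _ _)
  have hR' : ∀ j, F j + (R - F j) = R := fun j => by abel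
  have hRm : ∀ j : ℕ, R - F j ∈ ordLT δ (-j + 1) := fun j => ordLT_mono (by omega) (hR j)
  refine ⟨R, ?_, ?_⟩
  · have := (key 0).1.add (m := 0) le_rfl (by simpa using hRm 0)
    rwa [hR'] at this
  · refine (sub_eq_zero.1 (eq_zero_of_forall_mem (c := n) fun j => ?_)).symm
    have := (add_pow_sub_pow (key j).1 (by omega) (hRm j) n).1
    rw [hR'] at this
    rw [← sub_sub_sub_cancel_right _ _ (F j ^ n)]
    exact sub_mem (key j).2 (ordLT_mono (by omega) this)

theorem pow_inj [CharZero K] {R R' : PseudoDiffOp δ} {n : ℕ} (hn : n ≠ 0) (hR : IsMonic R 1)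
    (hR' : IsMonic R' 1) (h : R' ^ n = R ^ n) : R' = R := by
  by_contra hne
  have h0 : R' - R ≠ 0 := sub_ne_zero.2 hne
  have hm : (R' - R).ord ≤ 0 := by
    by_contra hc
    apply coeff_ord_ne_zero h0
    rcases eq_or_ne (R' - R).ord 1 with h1 | h1
    · rw [h1, coeff_sub, hR.2, hR'.2, sub_self]
    · rw [coeff_sub, hR.1 _ (by omega), hR'.1 _ (by omega), sub_self]
  have := (add_pow_sub_pow hR hm (R' - R).mem_ordLT_ord n).2
  rw [add_sub_cancel, h, sub_self, coeff_zero] at this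
  exact mul_ne_zero (Nat.cast_ne_zero.2 hn) (coeff_ord_ne_zero h0) this.symm

/-- An operator `∂ ^ m + (terms of order < m)` with `m ≠ 0` has exactly one `m`-th root of the form
`∂ + (terms of order < 1)`. -/
theorem existsUnique_root [CharZero K] {L : PseudoDiffOp δ} {m : ℤ} (hm : m ≠ 0)
    (hL : IsMonic L m) : ∃! R, IsMonic R 1 ∧ R ^ L.ord = L := by
  rw [hL.ord_eq]
  obtain ⟨n, rfl | rfl⟩ := m.eq_nat_or_neg
  · have hn : n ≠ 0 := by omega
    obtain ⟨R, h1, h2⟩ := exists_pow_eq hn hL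
    refine ⟨R, ⟨h1, by rwa [zpow_natCast]⟩, fun R' h => pow_inj hn h1 h.1 ?_⟩
    rw [h2, ← zpow_natCast, h.2]
  · have hn : n ≠ 0 := by omega
    obtain ⟨R, h1, h2⟩ := exists_pow_eq hn (by simpa using hL.inv)
    refine ⟨R, ⟨h1, by rw [zpow_neg, zpow_natCast, h2, inv_inv]⟩,
      fun R' h => pow_inj hn h1 h.1 ?_⟩
    rw [h2, ← zpow_natCast, ← inv_inj, ← zpow_neg, h.2, inv_inv]

open Classical in
/-- For `L = ∂ ^ k + (terms of order < k)` with `k ≠ 0`, the operator `L ^ (1 / k)`: the unique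
operator `R = ∂ + (terms of order < 1)` with `R ^ k = L`. -/
def root (L : PseudoDiffOp δ) : PseudoDiffOp δ :=
  if h : ∃ R, IsMonic R 1 ∧ R ^ L.ord = L then h.choose else 1

theorem root_spec [CharZero K] {L : PseudoDiffOp δ} {m : ℤ} (hm : m ≠ 0) (hL : IsMonic L m) :
    IsMonic L.root 1 ∧ L.root ^ L.ord = L := by
  have h := (existsUnique_root hm hL).exists
  rw [root, dif_pos h]
  exact h.choose_spec

/-- For `L = ∂ ^ k + (terms of order < k)` with `k ≠ 0` and `q = j / k` with an integer `j`, the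
operator `L ^ q = (L ^ (1 / k)) ^ j`. (If `q * k` is not an integer, the value has no meaning.) -/
def ratPow (L : PseudoDiffOp δ) (q : ℚ) : PseudoDiffOp δ := L.root ^ (q * L.ord).num

end DivisionRing

end

end PseudoDiffOp

noncomputable section

open scoped LaurentSeries

theorem LaurentSeries.derivative_leibniz {k : Type*} [Field k] (f g : k⸨X⸩) :
    LaurentSeries.derivative k (f * g) =
      f * LaurentSeries.derivative k g + LaurentSeries.derivative k f * g := by
  set θ : k⸨X⸩ → k⸨X⸩ := fun f => HahnSeries.ofSuppBddBelow (fun n => (n : k) * f.coeff n)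
    ⟨f.order, fun x h => by
      contrapose! h
      rw [Function.notMem_support, HahnSeries.coeff_eq_zero_of_lt_order h, mul_zero]⟩ with hθ
  have hc : ∀ f n, (θ f).coeff n = (n : k) * f.coeff n := fun _ _ => rfl
  have hd : ∀ f, LaurentSeries.derivative k f = HahnSeries.single (-1) 1 * θ f := by
    intro f
    ext n
    have := HahnSeries.coeff_single_mul_add (r := (1 : k)) (x := θ f) (a := n + 1) (b := -1)
    rw [add_neg_cancel_right] at this
    rw [this, hc]
    simp
  have hl : θ (f * g) = f * θ g + θ f * g := by
    ext n
    rw [hc, HahnSeries.coeff_add, HahnSeries.coeff_mul, 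
      HahnSeries.coeff_mul_right' (s := g.support) g.isPWO_support (fun n hn h => hn (by simp_all)),
      HahnSeries.coeff_mul_left' (s := f.support) f.isPWO_support (fun n hn h => hn (by simp_all)),
      Finset.mul_sum, ← Finset.sum_add_distrib]
    refine Finset.sum_congr rfl fun p hp => ?_
    have := (Finset.mem_antidiagonal.1 hp).2.2
    rw [hc, hc, ← this]
    push_cast
    ring
  rw [hd, hd, hd, hl]
  ring

/-- An additive map satisfying the Leibniz rule, as a derivation over `ℤ`. -/
def Derivation.ofLeibniz {A : Type*} [CommRing A] (f : A →+ A)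
    (h : ∀ a b, f (a * b) = a * f b + f a * b) : Derivation ℤ A A :=
  Derivation.mk' f.toIntLinearMap fun a b => by
    change f (a * b) = a * f b + b * f a
    rw [h, mul_comm b]

/-- The derivation `d / dx` of the field `k((x))`. -/
def LaurentSeries.ddx (k : Type*) [Field k] :=
  Derivation.ofLeibniz (A := k⸨X⸩) (LaurentSeries.derivative k).toAddMonoidHom
    LaurentSeries.derivative_leibniz

/-- The skew field `P = k((x))((∂⁻¹))` in one variable. -/
abbrev LaurentPDO (k : Type*) [Field k] : Type _ := PseudoDiffOp (LaurentSeries.ddx k)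

namespace LaurentPDO

/-- The operator `∂`. -/
abbrev D (k : Type*) [Field k] : LaurentPDO k := PseudoDiffOp.D (LaurentSeries.ddx k)

/-- The operators of order `< m`. -/
abbrev ordLT (k : Type*) [Field k] (m : ℤ) : AddSubgroup (LaurentPDO k) :=
  PseudoDiffOp.ordLT (LaurentSeries.ddx k) m

/-- The residue `res_P L`: the coefficient of `x⁻¹ ∂⁻¹` in `L`. -/
def res {k : Type*} [Field k] (L : LaurentPDO k) : k := (L.coeff (-1)).coeff (-1)

end LaurentPDO

end

/-! Call `ρ (a_{-1})` the residue of `∑ a_i ∂ ^ i`, where `ρ` is an additive functional on the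
coefficient field whose kernel consists of the derivatives. Integration by parts together with
`(n - 1 - i choose n) = (-1) ^ n (i choose n)` shows that the residue vanishes on commutators. Hence
it is invariant under conjugation, and roots commute with conjugation since they are unique.

Conversely, put `R = L ^ (1 / k)` and `T = M ^ (1 / k)`. To solve `R S = S T` with `S ∈ 1 + P_-`,
suppose that `S` solves it up to an error `c ∂ ^ (-n)` and lower terms, with `n ≥ 1`. Then
`S⁻¹ R S = T + c ∂ ^ (-n) + …`, so `S⁻¹ R ^ n S - T ^ n` has `∂⁻¹`-coefficient `n c`, and equality
of the residues of `R ^ n` and `T ^ n` says that `c` is a derivative, `c = δ g`. As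
`[R, g ∂ ^ (-n)] = δ g ∂ ^ (-n) + …`, replacing `S` by `S - g ∂ ^ (-n)` improves the error by one
order. The successive corrections converge. -/

theorem inv_mul_mul_zpow₀ {G : Type*} [GroupWithZero G] {s : G} (hs : s ≠ 0) (a : G) (n : ℤ) :
    (s⁻¹ * a * s) ^ n = s⁻¹ * a ^ n * s := by
  cases n with
  | ofNat n => simpa only [Int.ofNat_eq_natCast, zpow_natCast] using GroupWithZero.conj_pow₀ hs
  | negSucc n =>
    rw [zpow_negSucc, zpow_negSucc, GroupWithZero.conj_pow₀ hs]
    simp only [mul_inv_rev, inv_inv, mul_assoc]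

namespace PseudoDiffOp

section CommRing

variable {A B : Type*} [CommRing A] [AddCommGroup B] {d : Derivation ℤ A A}

theorem mem_ordLT_of_coeff_eq_zero {f : PseudoDiffOp d} {m : ℤ} (hf : f ∈ ordLT d (m + 1))
    (h0 : f.coeff m = 0) : f ∈ ordLT d m := fun n hn => by
  rcases hn.eq_or_lt with rfl | h
  · exact h0
  · exact hf n h

theorem sub_mono_mem_ordLT {f : PseudoDiffOp d} {m : ℤ} (hf : f ∈ ordLT d (m + 1)) :
    f - mono d (f.coeff m) m ∈ ordLT d m :=
  mem_ordLT_of_coeff_eq_zero (sub_mem hf (mono_mem _ _)) (by simp [coeff_mono])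

theorem coeff_mul_subleading {f g : PseudoDiffOp d} {a b : ℤ} (hf : f ∈ ordLT d (a + 1))
    (hg : g ∈ ordLT d (b + 1)) :
    (f * g).coeff (a + b - 1) =
      f.coeff a * g.coeff (b - 1) + f.coeff (a - 1) * g.coeff b +
        a • (f.coeff a * d (g.coeff b)) := by
  have hlead : (mono d (f.coeff a) a * g).coeff (a + b - 1) =
      f.coeff a * g.coeff (b - 1) + a • (f.coeff a * d (g.coeff b)) := by
    rw [coeff_mono_mul _ _ _ _ (w := 1) (ordLT_mono (by push_cast; omega) hg),
      Finset.sum_range_succ, Finset.sum_range_one,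
      show a + b - 1 - a + (0 : ℕ) = b - 1 by push_cast; ring,
      show a + b - 1 - a + (1 : ℕ) = b by push_cast; ring]
    simp
  have hrest : ((f - mono d (f.coeff a) a) * g).coeff (a + b - 1) =
      f.coeff (a - 1) * g.coeff b := by
    rw [show a + b - 1 = a - 1 + b by ring,
      coeff_mul_top (ordLT_mono (by omega) (sub_mono_mem_ordLT hf)) hg]
    simp [coeff_mono]
  rw [← add_sub_cancel (mono d (f.coeff a) a) f, add_mul, coeff_add, hlead, add_sub_cancel, hrest]
  abel

theorem commutator_mem_ordLT {f g : PseudoDiffOp d} {a b : ℤ} (hf : f ∈ ordLT d (a + 1))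
    (hg : g ∈ ordLT d (b + 1)) : f * g - g * f ∈ ordLT d (a + b) := by
  refine mem_ordLT_of_coeff_eq_zero (sub_mem (ordLT_mono (by omega) (mul_mem_ordLT hf hg))
    (ordLT_mono (by omega) (mul_mem_ordLT hg hf))) ?_
  have hgf := coeff_mul_top hg hf
  rw [add_comm b a] at hgf
  rw [coeff_sub, coeff_mul_top hf hg, hgf, mul_comm, sub_self]

theorem coeff_commutator {f g : PseudoDiffOp d} {a b : ℤ} (hf : f ∈ ordLT d (a + 1))
    (hg : g ∈ ordLT d (b + 1)) :
    (f * g - g * f).coeff (a + b - 1) =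
      a • (f.coeff a * d (g.coeff b)) - b • (g.coeff b * d (f.coeff a)) := by
  have hgf := coeff_mul_subleading hg hf
  rw [add_comm b a] at hgf
  rw [coeff_sub, coeff_mul_subleading hf hg, hgf]
  ring

theorem exists_limit_of_step {P : ℕ → PseudoDiffOp d → Prop} {S₀ : PseudoDiffOp d} (h₀ : P 0 S₀)
    (hstep : ∀ j S, P j S → ∃ S', S' - S ∈ ordLT d (1 - j) ∧ P (j + 1) S') :
    ∃ S, ∀ j : ℕ, ∃ S', P j S' ∧ S - S' ∈ ordLT d (1 - j) := by
  choose! next hnext hP using hstep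
  let F : ℕ → PseudoDiffOp d := fun j => Nat.rec S₀ next j
  have hF : ∀ j, P j (F j) := fun j => Nat.rec h₀ (fun j ih => hP j _ ih) j
  obtain ⟨S, hS⟩ := exists_limit F fun j => hnext j _ (hF j)
  exact ⟨S, fun j => ⟨F j, hF j, hS j⟩⟩

/-- The residue of `L = ∑ a_i ∂ ^ i` with respect to a functional `ρ` on the coefficients, namely
`ρ (a_{-1})`. When `ρ` vanishes on derivatives this is a trace, and on Laurent series the choice of
the coefficient of `x⁻¹` for `ρ` gives `res_P`. -/
def residue (ρ : A →+ B) : PseudoDiffOp d →+ B where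
  toFun L := ρ (L.coeff (-1))
  map_zero' := map_zero ρ
  map_add' _ _ := map_add ρ _ _

theorem residue_apply (ρ : A →+ B) (L : PseudoDiffOp d) : residue ρ L = ρ (L.coeff (-1)) := rfl

theorem map_mul_iterate_deriv {ρ : A →+ B} (hρ : ∀ a, ρ (d a) = 0) (n : ℕ) (a b : A) :
    ρ (a * d^[n] b) = (-1 : ℤ) ^ n • ρ (d^[n] a * b) := by
  induction n generalizing a b with
  | zero => simp
  | succ n ih =>
    have hparts : ρ (d^[n] a * d b) = -ρ (d^[n + 1] a * b) := by
      rw [Function.iterate_succ_apply', mul_comm _ b, eq_neg_iff_add_eq_zero, ← map_add]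
      simpa using hρ (d^[n] a * b)
    rw [Function.iterate_succ_apply, ih, hparts, pow_succ, mul_neg_one, neg_smul, smul_neg]

theorem choose_natCast_sub_one_sub (i : ℤ) (n : ℕ) :
    Ring.choose (n - 1 - i) n = (-1) ^ n * Ring.choose i n := by
  have h := Ring.choose_neg (i + 1 - n) n
  rw [Units.smul_def, show -(i + 1 - n) = (n : ℤ) - 1 - i by ring,
    show i + 1 - n + n - 1 = i by ring] at h
  simpa [Int.negOnePow] using h

theorem map_mulTerm_swap {ρ : A →+ B} (hρ : ∀ a, ρ (d a) = 0) (f g : ℤ → A) (i : ℤ) (n : ℕ) :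
    ρ (mulTerm g f d (-1) (n - 1 - i, n)) = ρ (mulTerm f g d (-1) (i, n)) := by
  simp only [mulTerm, map_zsmul, map_mul_iterate_deriv hρ n (f i), choose_natCast_sub_one_sub]
  rw [show -1 - ((n : ℤ) - 1 - i) + n = i by ring, show -1 - i + (n : ℤ) = n - 1 - i by ring,
    smul_smul, mul_comm (Ring.choose i n), mul_comm (g _)]

theorem residue_mul_comm {ρ : A →+ B} (hρ : ∀ a, ρ (d a) = 0) (f g : PseudoDiffOp d) :
    residue ρ (f * g) = residue ρ (g * f) := by
  have hmul : ∀ f g : PseudoDiffOp d,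
      residue ρ (f * g) = ∑ᶠ p, ρ (mulTerm f.coeff g.coeff d (-1) p) := fun f g =>
    ρ.map_finsum (mulTerm_finite f g (-1))
  -- `(i, n) ↦ (n - 1 - i, n)` exchanges the powers of `∂` taken from the two factors.
  have hswap : Function.Involutive fun p : ℤ × ℕ => ((p.2 : ℤ) - 1 - p.1, p.2) := fun p => by
    simp
  rw [hmul, hmul, ← finsum_comp_equiv hswap.toPerm]
  exact finsum_congr fun p => (map_mulTerm_swap hρ g.coeff f.coeff p.1 p.2)

end CommRing

section Field

variable {K B : Type*} [Field K] [AddCommGroup B] {δ : Derivation ℤ K K}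
  {L M R S T : PseudoDiffOp δ} {m : ℤ}

theorem IsMonic.ne_zero (hL : IsMonic L m) : L ≠ 0 := by
  rintro rfl
  exact zero_ne_one hL.2

theorem IsMonic.sub_mem_ordLT (hL : IsMonic L m) (hM : IsMonic M m) : L - M ∈ ordLT δ m :=
  mem_ordLT_of_coeff_eq_zero (sub_mem hL.1 hM.1) (by rw [coeff_sub, hL.2, hM.2, sub_self])

theorem isMonic_congr (h : L - M ∈ ordLT δ m) : IsMonic L m ↔ IsMonic M m := by
  have hcoeff (n : ℤ) (hn : m ≤ n) : L.coeff n = M.coeff n := sub_eq_zero.1 (h n hn)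
  rw [IsMonic, IsMonic, mem_ordLT, mem_ordLT, hcoeff m le_rfl]
  exact and_congr_left' (forall₂_congr fun n hn => by rw [hcoeff n (by omega)])

theorem IsMonic.conj (hL : IsMonic L m) (hS : IsMonic S 0) : IsMonic (S⁻¹ * L * S) m := by
  simpa using (hS.inv.mul hL).mul hS

theorem isMonic_zpow_D (m : ℤ) : IsMonic (D δ ^ m) m := by
  obtain ⟨n, rfl | rfl⟩ := m.eq_nat_or_neg
  · rw [zpow_natCast]
    exact isMonic_D.pow n
  · rw [zpow_neg, zpow_natCast]
    exact (isMonic_D.pow n).inv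

theorem conj_sub_mem_ordLT (hL : IsMonic L m) (hS : S - 1 ∈ ordLT δ 0) :
    L - S⁻¹ * L * S ∈ ordLT δ (m - 1) := by
  have hS₀ : IsMonic S 0 := (isMonic_congr hS).2 isMonic_one
  have hcomm : L - S⁻¹ * L * S = S⁻¹ * ((S - 1) * L - L * (S - 1)) := by
    rw [sub_mul, mul_sub L, one_mul, mul_one, sub_sub_sub_cancel_right, mul_sub,
      inv_mul_cancel_left₀ hS₀.ne_zero, mul_assoc]
  rw [hcomm]
  exact ordLT_mono (by omega)
    (mul_mem_ordLT hS₀.inv.1 (commutator_mem_ordLT (a := -1) (by simpa using hS) hL.1))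

theorem coeff_inv_sub_inv {a : ℤ} (hL : IsMonic L m) (hM : IsMonic M m)
    (h : L - M ∈ ordLT δ (a + 1)) :
    (L⁻¹ - M⁻¹).coeff (a - 2 * m) = -(L - M).coeff a := by
  have htop := coeff_mul_top (a := -m + a) (b := -m)
    (ordLT_mono (by omega) (mul_mem_ordLT hL.inv.1 h)) hM.inv.1
  rw [coeff_mul_top hL.inv.1 h, hL.inv.2, hM.inv.2, one_mul, mul_one,
    show -m + a + -m = a - 2 * m by ring] at htop
  rw [inv_sub_inv' hL.ne_zero hM.ne_zero, ← neg_sub L M, mul_neg, neg_mul, coeff_neg, htop]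

theorem coeff_zpow_sub_zpow {a : ℤ} (ha : a ≤ 0) (hR : IsMonic R 1) (hT : IsMonic T 1)
    (h : R - T ∈ ordLT δ (a + 1)) (m : ℤ) :
    (R ^ m - T ^ m).coeff (a + m - 1) = m * (R - T).coeff a := by
  have hpow (n : ℕ) := add_pow_sub_pow hT ha h n
  simp only [add_sub_cancel] at hpow
  obtain ⟨n, rfl | rfl⟩ := m.eq_nat_or_neg
  · simpa only [zpow_natCast, Int.cast_natCast] using (hpow n).2
  · have hinv := coeff_inv_sub_inv (a := a + n - 1) (hR.pow n) (hT.pow n)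
      (by simpa using (hpow n).1)
    rw [(hpow n).2, show a + n - 1 - 2 * (n : ℤ) = a + -n - 1 by ring] at hinv
    simpa only [zpow_neg, zpow_natCast, Int.cast_neg, Int.cast_natCast, neg_mul] using hinv

theorem ratPow_intCast_div_ord (h : L.ord ≠ 0) (j : ℤ) : L.ratPow (j / L.ord) = L.root ^ j := by
  rw [ratPow, div_mul_cancel₀ _ (Int.cast_ne_zero.2 h), Rat.num_intCast]

theorem residue_conj {ρ : K →+ B} (hρ : ∀ f, ρ (δ f) = 0) (hS : S ≠ 0) (L : PseudoDiffOp δ) :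
    residue ρ (S⁻¹ * L * S) = residue ρ L := by
  rw [residue_mul_comm hρ, mul_inv_cancel_left₀ hS]

theorem intertwining_add_mono_mem_ordLT (hR : IsMonic R 1) (hRT : R - T ∈ ordLT δ 0) {n : ℤ}
    (h : R * S - S * T ∈ ordLT δ (n + 1)) {g : K} (hg : δ g = -(R * S - S * T).coeff n) :
    R * (S + mono δ g n) - (S + mono δ g n) * T ∈ ordLT δ n := by
  set G := mono δ g n with hG
  have hG_mem : G ∈ ordLT δ (n + 1) := mono_mem g n
  have hcoeff : (R * G - G * R).coeff n = δ g := by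
    simpa [hR.2, hG, coeff_mono] using coeff_commutator (a := 1) hR.1 hG_mem
  have hsplit : R * (S + G) - (S + G) * T =
      (R * S - S * T) + (R * G - G * R) + G * (R - T) := by
    simp only [mul_add, add_mul, mul_sub]; abel
  rw [hsplit]
  refine add_mem (mem_ordLT_of_coeff_eq_zero (add_mem h ?_) ?_)
    (ordLT_mono (by omega) (mul_mem_ordLT hG_mem hRT))
  · exact ordLT_mono (by omega) (commutator_mem_ordLT hR.1 hG_mem)
  · rw [coeff_add, hcoeff, hg, add_neg_cancel]

theorem sub_zpow_D_ord_mem_ordLT (h : ∃ m : ℤ, L - D δ ^ m ∈ ordLT δ (m - 1)) :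
    L - D δ ^ L.ord ∈ ordLT δ (L.ord - 1) := by
  obtain ⟨m, hm⟩ := h
  have hL : IsMonic L m := (isMonic_congr (ordLT_mono (by omega) hm)).2 (isMonic_zpow_D m)
  rwa [hL.ord_eq]

theorem isMonic_ord (h : ∃ m : ℤ, L - D δ ^ m ∈ ordLT δ (m - 1)) : IsMonic L L.ord :=
  (isMonic_congr (ordLT_mono (by omega) (sub_zpow_D_ord_mem_ordLT h))).2 (isMonic_zpow_D _)

theorem sub_mem_ordLT_iff_ord_eq (hL : ∃ m : ℤ, L - D δ ^ m ∈ ordLT δ (m - 1))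
    (hM : ∃ m : ℤ, M - D δ ^ m ∈ ordLT δ (m - 1)) :
    L - M ∈ ordLT δ (L.ord - 1) ↔ L.ord = M.ord := by
  refine ⟨fun h => ?_, fun h => ?_⟩
  · exact ((isMonic_congr (ordLT_mono (by omega) h)).1 (isMonic_ord hL)).ord_eq.symm
  · rw [← sub_sub_sub_cancel_right L M (D δ ^ L.ord)]
    refine sub_mem (sub_zpow_D_ord_mem_ordLT hL) ?_
    rw [h]
    exact sub_zpow_D_ord_mem_ordLT hM

variable [CharZero K]

theorem root_sub_root_mem_ordLT (hm : m ≠ 0) (hL : IsMonic L m) (hM : IsMonic M m)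
    (h : L - M ∈ ordLT δ (m - 1)) : L.root - M.root ∈ ordLT δ 0 := by
  obtain ⟨hR, hRL⟩ := root_spec hm hL
  obtain ⟨hT, hTM⟩ := root_spec hm hM
  have hRT : L.root - M.root ∈ ordLT δ (0 + 1) := hR.sub_mem_ordLT hT
  have htop := coeff_zpow_sub_zpow le_rfl hR hT hRT m
  rw [← hL.ord_eq, hRL, hL.ord_eq, ← hM.ord_eq, hTM, hM.ord_eq, h _ (by omega)] at htop
  exact mem_ordLT_of_coeff_eq_zero hRT
    ((mul_eq_zero.1 htop.symm).resolve_left (Int.cast_ne_zero.2 hm))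

theorem root_conj (hm : m ≠ 0) (hL : IsMonic L m) (hS : IsMonic S 0) :
    (S⁻¹ * L * S).root = S⁻¹ * L.root * S := by
  have hconj := hL.conj hS
  refine (existsUnique_root hm hconj).unique (root_spec hm hconj) ⟨(root_spec hm hL).1.conj hS, ?_⟩
  rw [inv_mul_mul_zpow₀ hS.ne_zero, hconj.ord_eq, ← hL.ord_eq, (root_spec hm hL).2]

theorem mem_range_deriv_of_natCast_mul {n : ℕ} (hn : n ≠ 0) {f : K}
    (hf : n * f ∈ Set.range δ) : f ∈ Set.range δ := by
  obtain ⟨g, hg⟩ := hf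
  have hn' : (n : K) ≠ 0 := Nat.cast_ne_zero.2 hn
  refine ⟨g / n, mul_left_cancel₀ hn' ?_⟩
  rw [← hg, ← nsmul_eq_mul, ← map_nsmul, nsmul_eq_mul, mul_div_cancel₀ _ hn']

theorem coeff_intertwining_mem_range {ρ : K →+ B} (hρ : Function.Exact δ ρ) (hT : IsMonic T 1)
    (hS : IsMonic S 0) {n : ℕ} (hn : n ≠ 0) (hres : residue ρ (R ^ n) = residue ρ (T ^ n))
    (h : R * S - S * T ∈ ordLT δ (-n + 1)) : (R * S - S * T).coeff (-n) ∈ Set.range δ := by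
  set E := S⁻¹ * (R * S - S * T) with hE
  have hconj : T + E = S⁻¹ * R * S := by
    rw [hE, mul_sub, inv_mul_cancel_left₀ hS.ne_zero, add_sub_cancel, mul_assoc]
  have hE_mem : E ∈ ordLT δ (-n + 1) := ordLT_mono (by omega) (mul_mem_ordLT hS.inv.1 h)
  have hE_coeff : E.coeff (-n) = (R * S - S * T).coeff (-n) := by
    have htop := coeff_mul_top hS.inv.1 h
    rwa [hS.inv.2, one_mul, ← hE, neg_zero, zero_add] at htop
  have hpow : ((T + E) ^ n - T ^ n).coeff (-1) = n * E.coeff (-n) := by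
    simpa using (add_pow_sub_pow hT (by omega) hE_mem n).2
  have hres_pow : residue ρ ((T + E) ^ n - T ^ n) = 0 := by
    rw [map_sub, hconj, GroupWithZero.conj_pow₀ hS.ne_zero,
      residue_conj hρ.apply_apply_eq_zero hS.ne_zero, hres, sub_self]
  rw [residue_apply, hpow, hρ] at hres_pow
  exact hE_coeff ▸ mem_range_deriv_of_natCast_mul hn hres_pow

theorem exists_intertwining_step {ρ : K →+ B} (hρ : Function.Exact δ ρ) (hR : IsMonic R 1)
    (hT : IsMonic T 1) (hRT : R - T ∈ ordLT δ 0) (hS : IsMonic S 0) {n : ℕ} (hn : n ≠ 0)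
    (hres : residue ρ (R ^ n) = residue ρ (T ^ n)) (h : R * S - S * T ∈ ordLT δ (-n + 1)) :
    ∃ S', S' - S ∈ ordLT δ (-n + 1) ∧ R * S' - S' * T ∈ ordLT δ (-n) := by
  obtain ⟨g, hg⟩ := coeff_intertwining_mem_range hρ hT hS hn hres h
  refine ⟨S + mono δ (-g) (-n), ?_, intertwining_add_mono_mem_ordLT hR hRT h (by rw [map_neg, hg])⟩
  rw [add_sub_cancel_left]
  exact mono_mem _ _

theorem exists_conj_of_residue_pow_eq {ρ : K →+ B} (hρ : Function.Exact δ ρ) (hR : IsMonic R 1)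
    (hT : IsMonic T 1) (hRT : R - T ∈ ordLT δ 0)
    (hres : ∀ n : ℕ, residue ρ (R ^ n) = residue ρ (T ^ n)) :
    ∃ S, S - 1 ∈ ordLT δ 0 ∧ T = S⁻¹ * R * S := by
  let IsApprox (j : ℕ) (S : PseudoDiffOp δ) : Prop :=
    S - 1 ∈ ordLT δ 0 ∧ R * S - S * T ∈ ordLT δ (-j)
  have hone : IsApprox 0 1 := ⟨by simp, by simpa using hRT⟩
  have hstep (j : ℕ) (S : PseudoDiffOp δ) (hS : IsApprox j S) :
      ∃ S', S' - S ∈ ordLT δ (1 - j) ∧ IsApprox (j + 1) S' := by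
    obtain ⟨S', hdiff, hS'⟩ := exists_intertwining_step hρ hR hT hRT
      ((isMonic_congr hS.1).2 isMonic_one) j.succ_ne_zero (hres _) (by simpa using hS.2)
    refine ⟨S', ordLT_mono (by push_cast; omega) hdiff, ?_, hS'⟩
    rw [← sub_add_sub_cancel S' S]
    exact add_mem (ordLT_mono (by push_cast; omega) hdiff) hS.1
  obtain ⟨S, hS⟩ := exists_limit_of_step hone hstep
  have hS1 : S - 1 ∈ ordLT δ 0 := by
    obtain ⟨S', hS', hdiff⟩ := hS 1
    rw [← sub_add_sub_cancel S S']
    exact add_mem (by simpa using hdiff) hS'.1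
  have hRS : R * S - S * T = 0 := eq_zero_of_forall_mem (c := 2) fun j => by
    obtain ⟨S', hS', hdiff⟩ := hS j
    have hsplit : R * S - S * T =
        (R * S' - S' * T) + (R * (S - S') - (S - S') * T) := by
      simp only [sub_mul, mul_sub]; abel
    rw [hsplit]
    exact add_mem (ordLT_mono (by omega) hS'.2)
      (sub_mem (ordLT_mono (by omega) (mul_mem_ordLT hR.1 hdiff))
        (ordLT_mono (by omega) (mul_mem_ordLT hdiff hT.1)))
  refine ⟨S, hS1, ?_⟩
  rw [mul_assoc, sub_eq_zero.1 hRS,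
    inv_mul_cancel_left₀ ((isMonic_congr hS1).2 isMonic_one).ne_zero]

end Field

end PseudoDiffOp

namespace LaurentPDO

open scoped LaurentSeries

variable (k : Type*) [Field k]

instance [CharZero k] : CharZero k⸨X⸩ :=
  charZero_of_injective_ringHom HahnSeries.C_injective

variable {k} in
theorem coeff_ddx (f : k⸨X⸩) (n : ℤ) :
    (LaurentSeries.ddx k f).coeff n = ((n + 1 : ℤ) : k) * f.coeff (n + 1) := by
  change (LaurentSeries.derivative k f).coeff n = _
  simp [LaurentSeries.derivative_apply, LaurentSeries.hasseDeriv_coeff]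

theorem exact_ddx_coeff_neg_one [CharZero k] :
    Function.Exact (LaurentSeries.ddx k) (HahnSeries.coeff.addMonoidHom (-1 : ℤ)) := by
  intro f
  refine ⟨fun hf => ?_, ?_⟩
  · refine ⟨HahnSeries.ofSuppBddBelow (fun n => f.coeff (n - 1) / n) ⟨f.order, fun n hn => ?_⟩, ?_⟩
    · contrapose! hn
      rw [Function.notMem_support, HahnSeries.coeff_eq_zero_of_lt_order (by omega), zero_div]
    · ext n
      rw [coeff_ddx]
      change ((n + 1 : ℤ) : k) * (f.coeff (n + 1 - 1) / ((n + 1 : ℤ) : k)) = f.coeff n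
      rw [add_sub_cancel_right]
      rcases eq_or_ne n (-1) with rfl | hn
      · simpa using hf.symm
      · exact mul_div_cancel₀ _ (Int.cast_ne_zero.2 (by omega))
  · rintro ⟨g, rfl⟩
    simp [coeff_ddx]

end LaurentPDO

open PseudoDiffOp in
theorem theorem2_general {K B : Type*} [Field K] [CharZero K] [AddCommGroup B]
    {δ : Derivation ℤ K K} {ρ : K →+ B} (hρ : Function.Exact δ ρ) {L M : PseudoDiffOp δ}
    (hL₀ : L.ord ≠ 0) (hL : IsMonic L L.ord) :
    (∃ S, S - 1 ∈ ordLT δ 0 ∧ M = S⁻¹ * L * S) ↔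
      L - M ∈ ordLT δ (L.ord - 1) ∧
        ∀ q : ℚ, (∃ j : ℤ, q = (j : ℚ) / (L.ord : ℚ)) →
          residue ρ (L.ratPow q) = residue ρ (M.ratPow q) := by
  constructor
  · rintro ⟨S, hS, rfl⟩
    have hS₀ := (isMonic_congr hS).2 isMonic_one
    refine ⟨conj_sub_mem_ordLT hL hS, fun q _ => ?_⟩
    rw [ratPow, ratPow, root_conj hL₀ hL hS₀, (hL.conj hS₀).ord_eq, inv_mul_mul_zpow₀ hS₀.ne_zero,
      residue_conj hρ.apply_apply_eq_zero hS₀.ne_zero]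
  · rintro ⟨hLM, hres⟩
    have hM : IsMonic M L.ord := (isMonic_congr (ordLT_mono (by omega) hLM)).1 hL
    have hord : M.ord = L.ord := hM.ord_eq
    obtain ⟨hR, hRL⟩ := root_spec hL₀ hL
    obtain ⟨hT, hTM⟩ := root_spec hL₀ hM
    have hpow (n : ℕ) : residue ρ (L.root ^ n) = residue ρ (M.root ^ n) := by
      have h := hres _ ⟨n, rfl⟩
      rwa [ratPow_intCast_div_ord hL₀, ← hord, ratPow_intCast_div_ord (hord ▸ hL₀),
        zpow_natCast, zpow_natCast] at h
    obtain ⟨S, hS, hST⟩ :=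
      exists_conj_of_residue_pow_eq hρ hR hT (root_sub_root_mem_ordLT hL₀ hL hM hLM) hpow
    refine ⟨S, hS, ?_⟩
    rw [← hTM, hST, inv_mul_mul_zpow₀ ((isMonic_congr hS).2 isMonic_one).ne_zero, hord, hRL]

theorem theorem2 (k : Type*) [Field k] [CharZero k] (L M : LaurentPDO k)
    (hL0 : L.ord ≠ 0) (hM0 : M.ord ≠ 0)
    (hL : ∃ m : ℤ, L - LaurentPDO.D k ^ m ∈ LaurentPDO.ordLT k (m - 1))
    (hM : ∃ m : ℤ, M - LaurentPDO.D k ^ m ∈ LaurentPDO.ordLT k (m - 1)) :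
    (∃ S : LaurentPDO k, S - 1 ∈ LaurentPDO.ordLT k 0 ∧ M = S⁻¹ * L * S) ↔
      (L.ord = M.ord ∧
        ∀ q : ℚ, (∃ j : ℤ, q = (j : ℚ) / (L.ord : ℚ)) →
          LaurentPDO.res (L.ratPow q) = LaurentPDO.res (M.ratPow q)) := by
  rw [← PseudoDiffOp.sub_mem_ordLT_iff_ord_eq hL hM]
  exact theorem2_general (LaurentPDO.exact_ddx_coeff_neg_one k) hL0 (PseudoDiffOp.isMonic_ord hL)
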